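/- Let $\boldsymbol\Theta\subset\mathbb R^{D}$ be a set with nonempty interior, and consider a system of $N$ sensors. For $j=1,\dots,N$, sensor $j$ observes $\mathbf x_j=[\mathbf x_{j1},\dots,\mathbf x_{jL_j}]$ (a vector divided into $L_j$ subvectors), which takes values in a set $\mathscr X_j$ with a $\sigma$-algebra $\mathscr F_j$ and has, under the parameter $\boldsymbol\theta\in\boldsymbol\Theta$, the law $\mathscr P_j^{\boldsymbol\theta}$, an arbitrary probability measure on $(\mathscr X_j,\mathscr F_j)$; the observations $\mathbf x_1,\dots,\mathbf x_N$ are independent. Each subvector is quantized to $$u_{jl}=\gamma_{jl}(\mathbf x_{jl})=\sum_{r=1}^{R_{jl}} r\,\mathbb 1\{\mathbf x_{jl}\in I_{jl}^{(r)}\},$$ where the regions $I_{jl}^{(1)},\dots,I_{jl}^{(R_{jl})}$ are disjoint and cover the set of values of $\mathbf x_{jl}$, and where the map $\Gamma_j(\mathbf x_j)=[\gamma_{j1}(\mathbf x_{j1}),\dots,\gamma_{jL_j}(\mathbf x_{jL_j})]$ from $\mathscr X_j$ to $\mathbb R^{L_j}$ is measurable. The data are $\mathbf u=[\Gamma_1(\mathbf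 x_1),\dots,\Gamma_N(\mathbf x_N)]$. Let $\mathcal S_j=\prod_{l=1}^{L_j}\{1,\dots,R_{jl}\}$. Distinct points $\boldsymbol\theta,\boldsymbol\theta'\in\boldsymbol\Theta$ are called observationally equivalent if $\Pr(\mathbf u=\mathbf a\mid\boldsymbol\theta)=\Pr(\mathbf u=\mathbf a\mid\boldsymbol\theta')$ for all $\mathbf a\in\mathcal S_1\times\dots\times\mathcal S_N$. A point $\boldsymbol\theta\in\boldsymbol\Theta$ is identifiable if no other point of $\boldsymbol\Theta$ is observationally equivalent to it, and $\boldsymbol\Theta$ is identifiable if all its points are. Assume that for all $j$ and all $\mathbf s\in\mathcal S_j$ the cell probability $q_j^{(\mathbf s)}(\boldsymbol\theta)=\mathscr P_j^{\boldsymbol\theta}(\Gamma_j(\mathbf x_j)=\mathbf s)$ is continuous in $\boldsymbol\theta\in\boldsymbol\Theta$, and that $$D>\lambda(N,\{R_{jl}\}):=\sum_{j=1}^N\prod_{l=1}^{L_j}R_{jl}-N .$$ Then $\boldsymbol\Theta$ is not identifiable. Moreover, every nonempty subset $\mathcal U\subset\boldsymbol\Theta$ that is open in $\mathbb R^{D}$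 contains infinitely many points that are not identifiable. -/

import Mathlib

open MeasureTheory

universe u

noncomputable section

namespace QuantizedEstimation

/-- The vector quantizer `γ` with `R` levels and quantization regions `I 0, …, I (R - 1)`:
`γ y = ∑ r, r · 1{y ∈ I^(r)}`, where the region `I r` (`r : Fin R`) carries the level `r + 1`, so
that the levels are `1, …, R`. -/
def vectorQuantizer {R : ℕ} {Y : Type u} (I : Fin R → Set Y) (y : Y) : ℝ :=
  ∑ r : Fin R, ((r : ℝ) + 1) * (I r).indicator (fun _ => (1 : ℝ)) y

/-- The superquantizer `Γ`: it quantizes every part `x l` of an observation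
`x = [x 0, …, x (L - 1)]` by the vector quantizer with regions `I l`. -/
def superquantizer {L : ℕ} {R : Fin L → ℕ} {Y : Fin L → Type u}
    (I : ∀ l, Fin (R l) → Set (Y l)) (x : ∀ l, Y l) : Fin L → ℝ :=
  fun l => vectorQuantizer (I l) (x l)

/-- A quantized estimation system with parameter space `Θ`, with `N` sensors, with `L j` vector
quantizers at sensor `j`, the `l`-th of which has `R j l` levels. -/
structure System {D : ℕ} (Θ : Set (EuclideanSpace ℝ (Fin D))) (N : ℕ) (L : Fin N → ℕ)
    (R : ∀ j, Fin (L j) → ℕ) where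
  /-- The set in which the `l`-th observation subvector `x_{jl}` lies (such as `ℝ^k`). -/
  Y : ∀ j, Fin (L j) → Type u
  /-- The set `𝒳_j` of the observations `x_j = [x_{j1}, …, x_{jL_j}]` of sensor `j`. -/
  X : ∀ j, Set (∀ l, Y j l)
  /-- The σ-algebra on `𝒳_j`. -/
  [sigma : ∀ j, MeasurableSpace (X j)]
  /-- The family of probability measures of `x_j`, indexed by the parameter. -/
  P : ∀ j, Θ → Measure (X j)
  /-- They are probability measures. -/
  prob : ∀ j θ, IsProbabilityMeasure (P j θ)
  /-- The quantization regions. -/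
  I : ∀ j l, Fin (R j l) → Set (Y j l)
  /-- The regions of each quantizer are disjoint. -/
  disjoint : ∀ j l, Pairwise (Function.onFun Disjoint (I j l))
  /-- The regions of each quantizer cover its domain, the set of all values of `x_{jl}`. -/
  cover : ∀ j l, (fun x : (∀ l, Y j l) => x l) '' X j ⊆ ⋃ r, I j l r
  /-- Every superquantizer is measurable into `ℝ^{L_j}` with its Borel σ-algebra. -/
  measurable : ∀ j, Measurable (fun x : X j => superquantizer (I j) x.1)

attribute [instance] System.sigma System.prob

/-- The inestimable dimension for quantized data, `λ(N, {R_{jl}}) = ∑_j ∏_l R_{jl} - N`. -/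
def idqd (N : ℕ) {L : Fin N → ℕ} (R : ∀ j, Fin (L j) → ℕ) : ℤ :=
  (∑ j, ∏ l, (R j l : ℤ)) - N

/-- The outcome of a superquantizer, as a vector in `ℝ^L` with entries in `{1, …, R l}`, that is
indexed by the tuple of regions `s`. As `s` varies, these are the `∏_l R l` possible outcomes. -/
def outcome {L : ℕ} {R : Fin L → ℕ} (s : ∀ l, Fin (R l)) : Fin L → ℝ :=
  fun l => (s l : ℝ) + 1

namespace System

variable {D : ℕ} {Θ : Set (EuclideanSpace ℝ (Fin D))} {N : ℕ} {L : Fin N → ℕ}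
  {R : ∀ j, Fin (L j) → ℕ} (S : System.{u} Θ N L R)

/-- The superquantized vector `u_j = Γ_j(x_j)`. -/
def Gam (j : Fin N) (x : S.X j) : Fin (L j) → ℝ :=
  superquantizer (S.I j) x.1

/-- The cell probability `q_j^(s)(θ) = P_j^θ(Γ_j(x_j) = s)`. -/
def q (j : Fin N) (s : ∀ l, Fin (R j l)) (θ : Θ) : ℝ :=
  (S.P j θ).real {x | S.Gam j x = outcome s}

/-- The joint law of `(x_1, …, x_N)` under the parameter `θ`: the observations of the different
sensors are independent. -/
def jointLaw (θ : Θ) : Measure (∀ j, S.X j) :=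
  Measure.pi fun j => S.P j θ

/-- `Pr(u = a | θ)` for the possible realization `a = [a_1, …, a_N]` of the quantized data
`u = [Γ_1(x_1), …, Γ_N(x_N)]`. -/
def Pr (a : ∀ j, ∀ l, Fin (R j l)) (θ : Θ) : ℝ :=
  (S.jointLaw θ).real {x | ∀ j, S.Gam j (x j) = outcome (a j)}

/-- Two distinct parameter points are observationally equivalent if they give the same
probability to every possible realization of the quantized data. -/
def ObservationallyEquivalent (θ θ' : Θ) : Prop :=
  θ ≠ θ' ∧ ∀ a, S.Pr a θ = S.Pr a θ'

/-- A parameter point is identifiable if no other one is observationally equivalent to it. -/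
def IdentifiablePoint (θ : Θ) : Prop :=
  ¬ ∃ θ' : Θ, θ' ≠ θ ∧ S.ObservationallyEquivalent θ θ'

/-- The parameter space is identifiable if all its points are. -/
def IdentifiableSpace : Prop :=
  ∀ θ : Θ, S.IdentifiablePoint θ

end System

end QuantizedEstimation

end

/-!
The cell probabilities of sensor `j` sum to one, so they are determined by all but one of them, and
the law of the quantized data is determined by `λ = ∑ j, (∏ l, R j l - 1)` continuous real functions
of the parameter (`QuantizedEstimation.System.Pr_eq_of_forall_ne`). Since `λ < D`, invariance of
dimension (`IsOpen.not_injOn_of_finrank_lt`) shows that these functions do not separate the points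
of any nonempty open subset of `Θ`, so each such subset contains a point that is not identifiable.
If an open `U` contained only finitely many of them, then removing them would leave a nonempty open
set without any.

Invariance of dimension is reduced to a weak form of Brouwer's theorem. Let `f` be a continuous
injection of the closed unit ball of `E` into `F`, with `dim F < dim E`. Its inverse extends
continuously to all of `F`, and a `C¹` approximation `h : F → E` of that extension has a range of
Hausdorff dimension less than `dim E`. So `h` misses points `c` as close to `0` as desired. Then
`x ↦ h (f x) - c` is nearly the identity on the ball and has no zero. After smoothing, this
contradicts `exists_eq_zero_of_norm_sub_le`.

That lemma follows from the nonexistence of a `C¹` retraction `r` of the ball onto the sphere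
(`not_exists_contDiff_retraction_sphere`), which is proved by the Milnor–Rogers volume argument. For
small `t > 0`, the map `x ↦ x + t (r x - x)` is a diffeomorphism of the ball onto itself, so the
integral of its Jacobian determinant is the volume of the ball. That integral is a polynomial in
`t`, so it has the same value at `t = 1`. But there the determinant is that of `Dr`, which vanishes
because `r` has values in the sphere.
-/

open Module Metric Set Filter Topology

/-! ### Determinants of perturbations of the identity -/

namespace ContinuousLinearMap

variable {E : Type*} [NormedAddCommGroup E] [NormedSpace ℝ E]

/-- The determinant of `1 + t A` is a polynomial in `t` of degree at most `finrank ℝ E`. -/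
theorem exists_polynomial_det_one_add_smul [FiniteDimensional ℝ E] (A : E →L[ℝ] E) :
    ∃ P : Polynomial ℝ, P.natDegree ≤ finrank ℝ E ∧ ∀ t : ℝ, P.eval t = (1 + t • A).det := by
  classical
  set b := finBasis ℝ E
  set M : Matrix (Fin (finrank ℝ E)) (Fin (finrank ℝ E)) ℝ := LinearMap.toMatrix b b A
  refine ⟨((Polynomial.X : Polynomial ℝ) • M.map Polynomial.C
    + (1 : Matrix _ _ ℝ).map Polynomial.C).det, ?_, fun t => ?_⟩
  · simpa using Polynomial.natDegree_det_X_add_C_le M 1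
  · rw [← Polynomial.coe_evalRingHom, RingHom.map_det, ContinuousLinearMap.det,
      ← LinearMap.det_toMatrix b]
    congr 1
    ext i j
    simp [M, Matrix.one_apply, apply_ite (Polynomial.eval t), LinearMap.toMatrix_apply,
      Finsupp.single_apply, eq_comm, add_comm]
    exact mul_comm _ _

/-- Lagrange interpolation at nodes in `(0, T)`: the coefficients do not depend on `A`, because
`t ↦ det (1 + t A)` is a polynomial of degree at most `finrank ℝ E`. -/
theorem exists_det_one_add_eq_sum [FiniteDimensional ℝ E] {T : ℝ} (hT : 0 < T) :
    ∃ (s : Finset ℕ) (t c : ℕ → ℝ), (∀ i, 0 < t i ∧ t i < T) ∧ ∑ i ∈ s, c i = 1 ∧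
      ∀ A : E →L[ℝ] E, (1 + A).det = ∑ i ∈ s, c i * (1 + t i • A).det := by
  classical
  set s := Finset.range (finrank ℝ E + 1)
  set t : ℕ → ℝ := fun i => T / (i + 2)
  have ht : Function.Injective t := by
    intro i j hij
    have hi : (0 : ℝ) < i + 2 := by positivity
    have hj : (0 : ℝ) < j + 2 := by positivity
    simp only [t] at hij
    rw [div_eq_div_iff hi.ne' hj.ne'] at hij
    have := mul_left_cancel₀ hT.ne' hij
    have h2 : (i : ℝ) = j := by linarith
    exact_mod_cast h2
  have key : ∀ P : Polynomial ℝ, P.natDegree ≤ finrank ℝ E →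
      P.eval 1 = ∑ i ∈ s, (Lagrange.basis s t i).eval 1 * P.eval (t i) := by
    intro P hP
    have hdeg : P.degree < (s.card : WithBot ℕ) := by
      refine Polynomial.degree_le_natDegree.trans_lt ?_
      simp only [s, Finset.card_range]
      exact_mod_cast Nat.lt_succ_of_le hP
    have h := Lagrange.eq_interpolate (ht.injOn) hdeg
    conv_lhs => rw [h]
    simp [Lagrange.interpolate_apply, Polynomial.eval_finsetSum, mul_comm]
  refine ⟨s, t, fun i => (Lagrange.basis s t i).eval 1, fun i => ⟨by positivity, ?_⟩, ?_,
    fun A => ?_⟩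
  · have : (0 : ℝ) ≤ i := by positivity
    exact div_lt_self hT (by linarith)
  · simpa using (key 1 (by simp)).symm
  · obtain ⟨P, hP, hPe⟩ := exists_polynomial_det_one_add_smul A
    simpa [hPe] using key P hP

/-- The determinant of `1 + s A` does not vanish for `s ∈ [0, 1]`, and it is `1` at `s = 0`. -/
theorem det_one_add_pos [FiniteDimensional ℝ E] {A : E →L[ℝ] E} (hA : ‖A‖ < 1) :
    0 < (1 + A).det := by
  have hcont : Continuous fun s : ℝ => (1 + s • A).det :=
    ContinuousLinearMap.continuous_det.comp (by fun_prop)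
  have hne : ∀ s ∈ Icc (0 : ℝ) 1, (1 + s • A).det ≠ 0 := by
    intro s hs
    have hs' : ‖-(s • A)‖ < 1 := by
      rw [norm_neg, norm_smul, Real.norm_of_nonneg hs.1]
      exact (mul_le_of_le_one_left (norm_nonneg _) hs.2).trans_lt hA
    have hu : IsUnit (1 + s • A) := by
      simpa using isUnit_one_sub_of_norm_lt_one hs'
    have hl : IsUnit ((1 + s • A : E →L[ℝ] E) : E →ₗ[ℝ] E) :=
      hu.map (ContinuousLinearMap.toLinearMapRingHom (R₁ := ℝ) (M₁ := E))
    exact (hl.map (LinearMap.det (A := ℝ) (M := E))).ne_zero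
  by_contra! h
  have h0 : (0 : ℝ) ∈ (fun s : ℝ => (1 + s • A).det) '' Icc 0 1 := by
    apply intermediate_value_Icc' zero_le_one hcont.continuousOn
    refine ⟨by simpa using h, ?_⟩
    simp [ContinuousLinearMap.det]
  obtain ⟨s, hs, hs0⟩ := h0
  exact hne s hs hs0

end ContinuousLinearMap

/-! ### No retraction onto the sphere, and invariance of dimension -/

section InvarianceOfDimension

variable {E : Type*} [NormedAddCommGroup E] [InnerProductSpace ℝ E]

/-- The range of the derivative of `r` at `x` is orthogonal to `r x`. -/
theorem det_fderiv_eq_zero_of_norm_eq_one [FiniteDimensional ℝ E] {r : E → E}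
    (hr : Differentiable ℝ r) (h1 : ∀ x, ‖r x‖ = 1) (x : E) : (fderiv ℝ r x).det = 0 := by
  by_contra hdet
  have hsurj : Function.Surjective (fderiv ℝ r x) :=
    (LinearMap.equivOfDetNeZero (fderiv ℝ r x : E →ₗ[ℝ] E) hdet).surjective
  obtain ⟨v, hv⟩ := hsurj (r x)
  have hd := (hr x).hasFDerivAt.norm_sq
  have hc : (fun y => ‖r y‖ ^ 2) = fun _ => (1 : ℝ) := by
    funext y; simp [h1 y]
  rw [hc] at hd
  have := congrArg (fun L : E →L[ℝ] ℝ => L v) (hd.unique (hasFDerivAt_const (1 : ℝ) x))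
  simp [hv, h1 x] at this

variable [FiniteDimensional ℝ E]

/-- No `C¹` map with values in the unit sphere is the identity on the sphere. For convenience the
map is defined on all of `E` and is the radial projection outside the open unit ball. -/
theorem not_exists_contDiff_retraction_sphere {r : E → E} (hr : ContDiff ℝ 1 r)
    (h1 : ∀ x, ‖r x‖ = 1) (hout : ∀ x, 1 ≤ ‖x‖ → r x = ‖x‖⁻¹ • x) : False := by
  borelize E
  let μ : MeasureTheory.Measure E := MeasureTheory.Measure.addHaar
  let φ : ContDiffBump (0 : E) := ⟨1, 2, one_pos, one_lt_two⟩
  set B : Set E := closedBall 0 1 with hB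
  set A : E → E →L[ℝ] E := fun x => fderiv ℝ r x - 1 with hA
  have hAc : Continuous A := (hr.continuous_fderiv one_ne_zero).sub continuous_const
  -- `w` extends `r - id` from the ball to a globally Lipschitz map, so that `id + u • w` is a
  -- homeomorphism of `E` for small `u`.
  set w : E → E := fun x => φ x • (r x - x) with hw
  have hwB : ∀ x ∈ B, w x = r x - x := fun x hx => by
    simp [hw, φ.one_of_mem_closedBall hx]
  obtain ⟨C, hC⟩ : ∃ C, LipschitzWith C w :=
    ContDiff.lipschitzWith_of_hasCompactSupport (𝕂 := ℝ) (n := 1)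
      (φ.hasCompactSupport.smul_right) (φ.contDiff.smul (hr.sub contDiff_id)) one_ne_zero
  obtain ⟨C', hC'⟩ : ∃ C', ∀ x ∈ B, ‖A x‖ ≤ C' :=
    (isCompact_closedBall (0 : E) 1).exists_bound_of_continuousOn hAc.continuousOn
  have hC'0 : 0 ≤ C' := (norm_nonneg _).trans (hC' 0 (by simp [hB]))
  have hden : (0 : ℝ) < C + C' + 1 := by positivity
  obtain ⟨s, t, c, ht, hc, hdet⟩ :=
    ContinuousLinearMap.exists_det_one_add_eq_sum (E := E) (T := (C + C' + 1)⁻¹) (by positivity)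
  have hvol : ∀ u : ℝ, 0 < u → u < (C + C' + 1)⁻¹ →
      ∫ x in B, (1 + u • A x).det ∂μ = μ.real B := by
    intro u hu0 hu
    have hu1 : u * (C + C' + 1) < 1 := by
      rwa [← lt_div_iff₀ hden, one_div]
    have huC : u * C < 1 := by nlinarith [C.coe_nonneg]
    have huC' : u * C' < 1 := by nlinarith [C.coe_nonneg]
    have hult : u < 1 := by nlinarith [C.coe_nonneg]
    set g : E → E := fun x => x + u • w x with hg
    -- `g` differs from the identity by a map with Lipschitz constant `u * C < 1`.
    have happ : ApproximatesLinearOn g (ContinuousLinearEquiv.refl ℝ E : E →L[ℝ] E) univ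
        (u.toNNReal * C) := by
      intro x _ y _
      have : g x - g y - (ContinuousLinearEquiv.refl ℝ E : E →L[ℝ] E) (x - y)
          = u • (w x - w y) := by
        simp [hg, smul_sub]; abel
      rw [this, norm_smul, Real.norm_of_nonneg hu0.le]
      push_cast
      rw [Real.coe_toNNReal _ hu0.le, mul_assoc]
      exact mul_le_mul_of_nonneg_left (hC.norm_sub_le x y) hu0.le
    have hsub : Subsingleton E ∨ u.toNNReal * C <
        ‖((ContinuousLinearEquiv.refl ℝ E).symm : E →L[ℝ] E)‖₊⁻¹ := by
      rcases subsingleton_or_nontrivial E with h | h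
      · exact Or.inl h
      · right
        have : ‖((ContinuousLinearEquiv.refl ℝ E).symm : E →L[ℝ] E)‖₊ = 1 := by
          apply NNReal.coe_injective
          exact ContinuousLinearMap.norm_id
        rw [this, inv_one, ← NNReal.coe_lt_coe]
        push_cast
        rwa [Real.coe_toNNReal _ hu0.le]
    have hinj : Function.Injective g := injOn_univ.1 (injOn_iff_injective.2 (happ.injective hsub))
    have hsurj : Function.Surjective g := happ.surjective hsub
    have hgB : ∀ x ∈ B, g x = x + u • (r x - x) := fun x hx => by simp [hg, hwB x hx]
    have himg : g '' B = B := by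
      apply Subset.antisymm
      · rintro _ ⟨x, hx, rfl⟩
        rw [hgB x hx]
        have hrB : r x ∈ B := by simp [hB, h1 x]
        exact (convex_closedBall (0 : E) 1).add_smul_sub_mem hx hrB ⟨hu0.le, hult.le⟩
      · intro y hy
        obtain ⟨x, rfl⟩ := hsurj y
        by_cases hx : ‖x‖ ≤ 1
        · exact ⟨x, by simpa [hB] using hx, rfl⟩
        · -- Outside the ball, `g` is radial and does not map into the ball.
          exfalso
          push Not at hx
          have hx0 : 0 < ‖x‖ := one_pos.trans hx
          have hgx : g x = (1 + u * φ x * (‖x‖⁻¹ - 1)) • x := by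
            simp only [hg, hw, hout x hx.le, add_smul, one_smul, mul_smul, sub_smul]
          have hφ0 : 0 ≤ φ x := φ.nonneg
          have hφ1 : φ x ≤ 1 := φ.le_one
          have huφ1 : u * φ x < 1 := by nlinarith
          have hn : ‖g x‖ = |1 + u * φ x * (‖x‖⁻¹ - 1)| * ‖x‖ := by
            rw [hgx, norm_smul, Real.norm_eq_abs]
          have h2 : (1 + u * φ x * (‖x‖⁻¹ - 1)) * ‖x‖ = ‖x‖ - u * φ x * (‖x‖ - 1) := by
            field_simp; ring
          have h3 : ‖g x‖ ≤ 1 := by simpa [hB] using hy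
          have h4 := mul_le_mul_of_nonneg_right
            (le_abs_self (1 + u * φ x * (‖x‖⁻¹ - 1))) hx0.le
          nlinarith
    have hderiv : ∀ x ∈ B, HasFDerivWithinAt g (1 + u • A x) B x := by
      intro x hx
      have hrx : HasFDerivAt r (fderiv ℝ r x) x := (hr.differentiable one_ne_zero x).hasFDerivAt
      have h := (hasFDerivAt_id x).add ((hrx.sub (hasFDerivAt_id x)).const_smul u)
      exact h.hasFDerivWithinAt.congr (fun y hy => hgB y hy) (hgB x hx)
    have hcv := MeasureTheory.integral_image_eq_integral_abs_det_fderiv_smul μ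
      (isClosed_closedBall (x := (0 : E)) (ε := 1)).measurableSet hderiv hinj.injOn
      (fun _ => (1 : ℝ))
    rw [himg] at hcv
    -- The bound `C'` on `‖A x‖` makes the determinant positive, which removes the absolute value.
    have hpos : ∀ x ∈ B, |(1 + u • A x).det| • (1 : ℝ) = (1 + u • A x).det := by
      intro x hx
      rw [smul_eq_mul, mul_one, abs_of_pos]
      apply ContinuousLinearMap.det_one_add_pos
      rw [norm_smul, Real.norm_of_nonneg hu0.le]
      exact (mul_le_mul_of_nonneg_left (hC' x hx) hu0.le).trans_lt huC'
    rw [MeasureTheory.setIntegral_congr_fun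
      (isClosed_closedBall (x := (0 : E)) (ε := 1)).measurableSet hpos] at hcv
    rw [← hcv]
    simp
  have hint : ∀ u : ℝ, MeasureTheory.IntegrableOn (fun x => (1 + u • A x).det) B μ := fun u =>
    (ContinuousLinearMap.continuous_det.comp (by fun_prop)).continuousOn.integrableOn_compact
      (isCompact_closedBall (0 : E) 1)
  -- By interpolation, the value of the integral at small `u` is also its value at `u = 1`.
  have hsum : ∫ x in B, (1 + A x).det ∂μ = μ.real B := by
    rw [funext fun x => hdet (A x)]
    rw [MeasureTheory.integral_finsetSum _ fun i _ => (hint (t i)).const_mul (c i)]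
    simp_rw [MeasureTheory.integral_const_mul]
    rw [Finset.sum_congr rfl fun i _ => by rw [hvol (t i) (ht i).1 (ht i).2], ← Finset.sum_mul,
      hc, one_mul]
  have hzero : ∀ x, (1 + A x).det = 0 := fun x => by
    simpa [hA] using det_fderiv_eq_zero_of_norm_eq_one (hr.differentiable one_ne_zero) h1 x
  simp only [hzero, MeasureTheory.integral_zero] at hsum
  have hBpos : 0 < μ B := measure_closedBall_pos μ 0 one_pos
  have hBfin : μ B ≠ ⊤ := (isCompact_closedBall (0 : E) 1).measure_lt_top.ne
  exact (ENNReal.toReal_pos hBpos.ne' hBfin).ne hsum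

/-- A map without zeros that is close to the identity on the unit ball would give a retraction onto
the sphere: interpolate between it and the identity near the sphere, and normalize. -/
theorem exists_eq_zero_of_norm_sub_le {p : E → E} (hp : ContDiff ℝ 1 p)
    (hclose : ∀ x, ‖x‖ ≤ 1 → ‖p x - x‖ ≤ 1 / 2) : ∃ x, p x = 0 := by
  by_contra! hne
  let φ : ContDiffBump (0 : E) := ⟨3 / 4, 1, by norm_num, by norm_num⟩
  set G : E → E := fun x => x + φ x • (p x - x) with hG
  have hGc : ContDiff ℝ 1 G := contDiff_id.add (φ.contDiff.smul (hp.sub contDiff_id))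
  have hGout : ∀ x, 1 ≤ ‖x‖ → G x = x := fun x hx => by
    have : φ x = 0 := φ.zero_of_le_dist (by simpa using hx)
    simp [hG, this]
  have hG0 : ∀ x, G x ≠ 0 := by
    intro x hx
    rcases le_or_gt ‖x‖ (3 / 4) with h | h
    · have h1 : φ x = 1 := φ.one_of_mem_closedBall (by simpa using h)
      exact hne x (by simpa [hG, h1] using hx)
    · rcases le_or_gt 1 ‖x‖ with h' | h'
      · rw [hGout x h'] at hx
        norm_num [hx] at h
      · have h2 : x = -(φ x • (p x - x)) := eq_neg_of_add_eq_zero_left hx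
        have h3 : ‖x‖ ≤ 1 / 2 := by
          calc ‖x‖ = φ x * ‖p x - x‖ := by
                conv_lhs => rw [h2]
                rw [norm_neg, norm_smul, Real.norm_of_nonneg φ.nonneg]
            _ ≤ 1 * ‖p x - x‖ := by gcongr; exact φ.le_one
            _ ≤ 1 / 2 := by rw [one_mul]; exact hclose x h'.le
        linarith
  refine not_exists_contDiff_retraction_sphere (r := fun x => ‖G x‖⁻¹ • G x)
    (((hGc.norm ℝ hG0).inv fun x => norm_ne_zero_iff.2 (hG0 x)).smul hGc) (fun x => ?_)
    fun x hx => by simp only [hGout x hx]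
  rw [norm_smul, norm_inv, norm_norm, inv_mul_cancel₀ (norm_ne_zero_iff.2 (hG0 x))]

variable {F : Type*} [NormedAddCommGroup F] [NormedSpace ℝ F] [FiniteDimensional ℝ F]

theorem not_injOn_closedBall_of_finrank_lt (hEF : finrank ℝ F < finrank ℝ E) {f : E → F}
    (hf : ContinuousOn f (closedBall 0 1)) : ¬ InjOn f (closedBall 0 1) := by
  intro hinj
  have : CompactSpace (closedBall (0 : E) 1) :=
    isCompact_iff_compactSpace.1 (isCompact_closedBall 0 1)
  let e : C(closedBall (0 : E) 1, F) := ⟨(closedBall (0 : E) 1).domRestrict f, hf.domRestrict⟩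
  have he : IsClosedEmbedding e := e.continuous.isClosedEmbedding hinj.injective
  -- `g` is a continuous left inverse of `f`, defined on all of `F`.
  obtain ⟨g, hg⟩ := ContinuousMap.exists_extension' (Y := E) he
    (⟨Subtype.val, continuous_subtype_val⟩ : C(closedBall (0 : E) 1, E))
  obtain ⟨f', hf'⟩ := ContinuousMap.exists_restrict_eq (Y := F)
    (isClosed_closedBall (x := (0 : E)) (ε := 1)) e
  obtain ⟨h, hh, hhg, -⟩ := g.continuous.exists_contDiff_approx 1
    (continuous_const (y := (1 / 8 : ℝ))) (fun _ => by norm_num)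
  obtain ⟨c, hc, hcr⟩ := (hh.dense_compl_range_of_finrank_lt_finrank hEF).exists_mem_open
    (isOpen_ball (x := (0 : E)) (ε := 1 / 8)) ⟨0, by simp⟩
  have hne : ∀ x, h (f' x) - c ≠ 0 := fun x hx => hc ⟨f' x, sub_eq_zero.1 hx⟩
  have hcont : Continuous fun x => h (f' x) - c :=
    (hh.continuous.comp f'.continuous).sub continuous_const
  -- The error is less than the norm of the approximated function, so `p` has no zero either.
  obtain ⟨p, hp, hpd, -⟩ := hcont.exists_contDiff_approx 1
    (hcont.norm.min (continuous_const (y := (1 / 8 : ℝ))))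
    (fun x => lt_min (norm_pos_iff.2 (hne x)) (by norm_num))
  obtain ⟨x, hx⟩ := exists_eq_zero_of_norm_sub_le hp (fun x hx => by
    have hxB : x ∈ closedBall (0 : E) 1 := by simpa using hx
    have h1 : f' x = f x := congrArg (fun k : C(closedBall (0 : E) 1, F) => k ⟨x, hxB⟩) hf'
    have h2 : g (f x) = x := congrFun hg ⟨x, hxB⟩
    have h3 := hhg (f x)
    rw [h2, dist_eq_norm] at h3
    have h4 := (hpd x).trans_le (min_le_right _ _)
    rw [h1, dist_eq_norm] at h4
    have h5 : ‖c‖ < 1 / 8 := by simpa using hcr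
    have h6 : p x - x = (p x - (h (f x) - c)) + (h (f x) - x) - c := by abel
    rw [h6]
    have h7 := norm_sub_le ((p x - (h (f x) - c)) + (h (f x) - x)) c
    have h8 := norm_add_le (p x - (h (f x) - c)) (h (f x) - x)
    linarith)
  have h9 := (hpd x).trans_le (min_le_left _ _)
  rw [hx, dist_eq_norm, zero_sub, norm_neg] at h9
  exact lt_irrefl _ h9

/-- **Invariance of dimension**: a continuous map into a space of smaller dimension is not injective
on a nonempty open set. -/
theorem IsOpen.not_injOn_of_finrank_lt (hEF : finrank ℝ F < finrank ℝ E) {U : Set E}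
    (hU : IsOpen U) (hne : U.Nonempty) {f : E → F} (hf : ContinuousOn f U) : ¬ InjOn f U := by
  intro hinj
  obtain ⟨x, hx⟩ := hne
  obtain ⟨ε, hε, hball⟩ := nhds_basis_closedBall.mem_iff.1 (hU.mem_nhds hx)
  have hmaps : MapsTo (fun y : E => x + ε • y) (closedBall 0 1) U := fun y hy => by
    apply hball
    have : ‖y‖ ≤ 1 := by simpa using hy
    rw [mem_closedBall, dist_eq_norm, add_sub_cancel_left, norm_smul, Real.norm_of_nonneg hε.le]
    exact mul_le_of_le_one_right hε.le this
  refine not_injOn_closedBall_of_finrank_lt hEF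
    (hf.comp (f := fun y : E => x + ε • y) (by fun_prop) hmaps) ?_
  refine hinj.comp (fun y _ z _ hyz => ?_) hmaps
  exact smul_right_injective E hε.ne' (add_left_cancel hyz)

end InvarianceOfDimension

/-! ### Quantized data -/

namespace QuantizedEstimation

theorem vectorQuantizer_eq {R : ℕ} {Y : Type u} {I : Fin R → Set Y}
    (hI : Pairwise (Function.onFun Disjoint I)) {y : Y} {r : Fin R} (hy : y ∈ I r) :
    vectorQuantizer I y = (r : ℝ) + 1 := by
  unfold vectorQuantizer
  rw [Finset.sum_eq_single r]
  · simp [hy]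
  · intro r' _ hr'
    simp [Set.disjoint_right.1 (hI hr') hy]
  · simp

theorem outcome_injective {L : ℕ} {R : Fin L → ℕ} :
    Function.Injective (outcome : (∀ l, Fin (R l)) → Fin L → ℝ) := by
  intro s s' h
  funext l
  simpa [outcome, Fin.ext_iff] using congrFun h l

namespace System

variable {D : ℕ} {Θ : Set (EuclideanSpace ℝ (Fin D))} {N : ℕ} {L : Fin N → ℕ}
  {R : ∀ j, Fin (L j) → ℕ} (S : System.{u} Θ N L R)

theorem exists_Gam_eq_outcome (j : Fin N) (x : S.X j) :
    ∃ s : ∀ l, Fin (R j l), S.Gam j x = outcome s := by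
  have h : ∀ l, ∃ r, x.1 l ∈ S.I j l r := fun l =>
    Set.mem_iUnion.1 (S.cover j l ⟨x.1, x.2, rfl⟩)
  choose s hs using h
  exact ⟨s, funext fun l => vectorQuantizer_eq (S.disjoint j l) (hs l)⟩

theorem sum_q (j : Fin N) (θ : Θ) : ∑ s, S.q j s θ = 1 := by
  classical
  have hm : Measurable (S.Gam j) := S.measurable j
  have h := sum_measureReal_preimage_singleton (μ := S.P j θ)
    (Finset.univ.image (outcome : (∀ l, Fin (R j l)) → Fin (L j) → ℝ)) (f := S.Gam j)
    fun y _ => hm (measurableSet_singleton y)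
  rw [Finset.sum_image outcome_injective.injOn] at h
  have huniv : S.Gam j ⁻¹'
      (Finset.univ.image (outcome : (∀ l, Fin (R j l)) → Fin (L j) → ℝ) : Finset _) = univ := by
    refine eq_univ_of_forall fun x => ?_
    obtain ⟨s, hs⟩ := S.exists_Gam_eq_outcome j x
    simp [hs]
  rw [huniv, probReal_univ] at h
  exact h

theorem Pr_eq_prod_q (a : ∀ j, ∀ l, Fin (R j l)) (θ : Θ) : S.Pr a θ = ∏ j, S.q j (a j) θ := by
  have h : {x : ∀ j, S.X j | ∀ j, S.Gam j (x j) = outcome (a j)} =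
      univ.pi fun j => {x | S.Gam j x = outcome (a j)} := by
    ext x; simp
  simp only [Pr, q, jointLaw, h, Measure.real, Measure.pi_pi, ENNReal.toReal_prod]

/-- One cell of each sensor is redundant, because the cell probabilities sum to one. -/
theorem Pr_eq_of_forall_ne {s₀ : ∀ j, ∀ l, Fin (R j l)} {θ θ' : Θ}
    (h : ∀ j s, s ≠ s₀ j → S.q j s θ = S.q j s θ') (a : ∀ j, ∀ l, Fin (R j l)) :
    S.Pr a θ = S.Pr a θ' := by
  have h₀ : ∀ j, S.q j (s₀ j) θ = S.q j (s₀ j) θ' := by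
    intro j
    have h1 := S.sum_q j θ
    have h2 := S.sum_q j θ'
    rw [← Finset.add_sum_erase _ _ (Finset.mem_univ (s₀ j))] at h1 h2
    rw [Finset.sum_congr rfl fun s hs => h j s (Finset.ne_of_mem_erase hs)] at h1
    linarith
  rw [Pr_eq_prod_q, Pr_eq_prod_q]
  refine Finset.prod_congr rfl fun j _ => ?_
  by_cases hj : a j = s₀ j
  · rw [hj, h₀ j]
  · exact h j _ hj

theorem exists_not_identifiablePoint
    (hq : ∀ (j : Fin N) (s : ∀ l, Fin (R j l)), Continuous fun θ : Θ => S.q j s θ)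
    (hD : idqd N R < (D : ℤ)) {V : Set (EuclideanSpace ℝ (Fin D))} (hV : IsOpen V)
    (hne : V.Nonempty) (hVΘ : V ⊆ Θ) :
    ∃ θ : Θ, (θ : EuclideanSpace ℝ (Fin D)) ∈ V ∧ ¬ S.IdentifiablePoint θ := by
  classical
  obtain ⟨v, hv⟩ := hne
  -- The law of `x_j` is a probability measure, so `x_j` has some value, and its cell exists.
  have hs : ∀ j, Nonempty (∀ l, Fin (R j l)) := fun j => by
    obtain ⟨x⟩ := (S.P j ⟨v, hVΘ hv⟩).nonempty_of_neZero
    exact ⟨(S.exists_Gam_eq_outcome j x).choose⟩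
  let s₀ : ∀ j, ∀ l, Fin (R j l) := fun j => (hs j).some
  let ι : Type := Σ j, {s : ∀ l, Fin (R j l) // s ≠ s₀ j}
  have hcard : (Fintype.card ι : ℤ) = idqd N R := by
    have hj : ∀ j, (Fintype.card {s : ∀ l, Fin (R j l) // s ≠ s₀ j} : ℤ)
        = (∏ l, (R j l : ℤ)) - 1 := fun j => by
      have h1 : Fintype.card {s : ∀ l, Fin (R j l) // s ≠ s₀ j}
          = Fintype.card (∀ l, Fin (R j l)) - 1 := Set.card_ne_eq (s₀ j)
      rw [h1, Nat.cast_sub Fintype.card_pos]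
      simp
    rw [Fintype.card_sigma, Nat.cast_sum, Finset.sum_congr rfl fun j _ => hj j]
    simp [idqd]
  -- The value outside `Θ` is irrelevant.
  let f : EuclideanSpace ℝ (Fin D) → ι → ℝ := fun x i =>
    if h : x ∈ Θ then S.q i.1 i.2.1 ⟨x, h⟩ else 0
  have hf : ∀ (θ : Θ) (i : ι), f θ i = S.q i.1 i.2.1 θ := fun θ i => dif_pos θ.2
  have hfc : ContinuousOn f Θ := by
    rw [continuousOn_iff_continuous_domRestrict]
    refine continuous_pi fun i => ?_
    have : (fun θ : Θ => Θ.domRestrict f θ i) = fun θ => S.q i.1 i.2.1 θ :=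
      funext fun θ => hf θ i
    rw [this]
    exact hq _ _
  have hrank : finrank ℝ (ι → ℝ) < finrank ℝ (EuclideanSpace ℝ (Fin D)) := by
    rw [finrank_fintype_fun_eq_card, finrank_euclideanSpace_fin]
    rw [← hcard] at hD
    exact_mod_cast hD
  have hinj := hV.not_injOn_of_finrank_lt hrank ⟨v, hv⟩ (hfc.mono hVΘ)
  simp only [InjOn, not_forall] at hinj
  obtain ⟨x, hx, y, hy, hxy, hne⟩ := hinj
  have hθ : (⟨x, hVΘ hx⟩ : Θ) ≠ ⟨y, hVΘ hy⟩ := fun h => hne (congrArg Subtype.val h)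
  refine ⟨⟨x, hVΘ hx⟩, hx, not_not.2 ⟨⟨y, hVΘ hy⟩, hθ.symm, hθ, ?_⟩⟩
  refine S.Pr_eq_of_forall_ne (s₀ := s₀) fun j s hs => ?_
  rw [← hf ⟨x, hVΘ hx⟩ ⟨j, s, hs⟩, ← hf ⟨y, hVΘ hy⟩ ⟨j, s, hs⟩]
  exact congrFun hxy _

end System

end QuantizedEstimation

theorem theorem2 {D : ℕ} (Θ : Set (EuclideanSpace ℝ (Fin D)))
    (hΘ : (interior Θ).Nonempty)
    (N : ℕ) (L : Fin N → ℕ) (R : ∀ j, Fin (L j) → ℕ)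
    (S : QuantizedEstimation.System.{u} Θ N L R)
    (hq : ∀ (j : Fin N) (s : ∀ l, Fin (R j l)), Continuous fun θ : Θ => S.q j s θ)
    (hD : QuantizedEstimation.idqd N R < (D : ℤ)) :
    ¬ S.IdentifiableSpace ∧
      ∀ U : Set (EuclideanSpace ℝ (Fin D)), IsOpen U → U.Nonempty → U ⊆ Θ →
        {θ : Θ | (θ : EuclideanSpace ℝ (Fin D)) ∈ U ∧ ¬ S.IdentifiablePoint θ}.Infinite := by
  have hinf : ∀ U : Set (EuclideanSpace ℝ (Fin D)), IsOpen U → U.Nonempty → U ⊆ Θ →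
      {θ : Θ | (θ : EuclideanSpace ℝ (Fin D)) ∈ U ∧ ¬ S.IdentifiablePoint θ}.Infinite := by
    intro U hU hUne hUΘ hfin
    obtain ⟨θ, hθU, hθ⟩ := S.exists_not_identifiablePoint hq hD hU hUne hUΘ
    -- The second point makes the space nontrivial, so that nonempty open sets are infinite.
    have hθne : ∃ θ' : Θ, θ' ≠ θ := by
      obtain ⟨θ', h, -⟩ := not_not.1 hθ
      exact ⟨θ', h⟩
    obtain ⟨θ', hθ'⟩ := hθne
    have : Nontrivial (EuclideanSpace ℝ (Fin D)) :=
      ⟨θ', θ, fun h => hθ' (Subtype.ext h)⟩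
    set B := {θ : Θ | (θ : EuclideanSpace ℝ (Fin D)) ∈ U ∧ ¬ S.IdentifiablePoint θ}
    have hBfin : (Subtype.val '' B).Finite := hfin.image _
    have hVne : (U \ Subtype.val '' B).Nonempty :=
      ((infinite_of_mem_nhds (θ : EuclideanSpace ℝ (Fin D)) (hU.mem_nhds hθU)).sdiff hBfin).nonempty
    obtain ⟨η, hη, hηi⟩ := S.exists_not_identifiablePoint hq hD (hU.sdiff hBfin.isClosed) hVne
      (sdiff_subset.trans hUΘ)
    exact hη.2 ⟨η, ⟨hη.1, hηi⟩, rfl⟩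
  refine ⟨fun hid => ?_, hinf⟩
  obtain ⟨θ, -, hθ⟩ := (hinf _ isOpen_interior hΘ interior_subset).nonempty
  exact hθ (hid θ)
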